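/- All groups are abelian, written additively. Let $L=\{+,0\}$ be the vocabulary of groups. For infinite cardinals $\mu\le\kappa$, let $L_{\kappa\mu}$ be the infinitary logic whose formulas are built from the atomic $L$-formulas (equations between terms) by negation, conjunctions and disjunctions of families of fewer than $\kappa$ formulas, and existential and universal quantification over strings of fewer than $\mu$ variables. Two groups are $L_{\kappa\mu}$-equivalent if the same $L_{\kappa\mu}$-sentences hold in both. A group $G$ is a Whitehead group (W-group) if $\operatorname{Ext}^1_{\mathbb Z}(G,\mathbb Z)=0$. Let $\mathbb Z^\omega$ be the Baer-Specker group, the product of countably many copies of $\mathbb Z$. **Corollary.** If $G$ is a W-group, then $\mathbb Z^\omega$ is not $L_{(2^{\aleph_0})^+\,\aleph_1}$-equivalent to $G$. -/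

import Mathlib

universe u v w

/-- The formulas of the infinitary logic `L_{κμ}` over a first-order vocabulary `L`, with free
variables indexed by a type. The formulas are built from the atomic formulas by negation,
conjunctions and disjunctions of families of fewer than `κ` formulas, and existential and
universal quantification over strings of fewer than `μ` variables. A quantifier over a string
indexed by `β` binds the variables `Sum.inr b`, `b : β`. -/
inductive InfFormula (L : FirstOrder.Language.{0, 0}) (κ μ : Cardinal.{u}) :
    Type u → Type (u + 1)
  | equal {α : Type u} (s t : L.Term α) : InfFormula L κ μ α
  | rel {α : Type u} {n : ℕ} (R : L.Relations n) (ts : Fin n → L.Term α) : InfFormula L κ μ α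
  | neg {α : Type u} (φ : InfFormula L κ μ α) : InfFormula L κ μ α
  | conj {α : Type u} (ι : Type u) (hι : Cardinal.mk ι < κ) (φ : ι → InfFormula L κ μ α) :
      InfFormula L κ μ α
  | disj {α : Type u} (ι : Type u) (hι : Cardinal.mk ι < κ) (φ : ι → InfFormula L κ μ α) :
      InfFormula L κ μ α
  | ex {α : Type u} (β : Type u) (hβ : Cardinal.mk β < μ) (φ : InfFormula L κ μ (α ⊕ β)) :
      InfFormula L κ μ α
  | all {α : Type u} (β : Type u) (hβ : Cardinal.mk β < μ) (φ : InfFormula L κ μ (α ⊕ β)) :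
      InfFormula L κ μ α

/-- Satisfaction of an `L_{κμ}`-formula in an `L`-structure `M` under an assignment `a` of its
free variables. -/
def InfFormula.Realize {L : FirstOrder.Language.{0, 0}} {κ μ : Cardinal.{u}}
    (M : Type v) [L.Structure M] : {α : Type u} → InfFormula L κ μ α → (α → M) → Prop
  | _, .equal s t, a => s.realize a = t.realize a
  | _, .rel R ts, a => FirstOrder.Language.Structure.RelMap R fun i => (ts i).realize a
  | _, .neg φ, a => ¬ φ.Realize M a
  | _, .conj _ _ φ, a => ∀ i, (φ i).Realize M a
  | _, .disj _ _ φ, a => ∃ i, (φ i).Realize M a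
  | _, .ex β _ φ, a => ∃ b : β → M, φ.Realize M (Sum.elim a b)
  | _, .all β _ φ, a => ∀ b : β → M, φ.Realize M (Sum.elim a b)

/-- An `L_{κμ}`-sentence is an `L_{κμ}`-formula without free variables. -/
abbrev InfSentence (L : FirstOrder.Language.{0, 0}) (κ μ : Cardinal.{u}) : Type (u + 1) :=
  InfFormula L κ μ PEmpty.{u + 1}

/-- The sentence `φ` holds in the structure `M`. -/
def InfSentence.Holds {L : FirstOrder.Language.{0, 0}} {κ μ : Cardinal.{u}}
    (φ : InfSentence L κ μ) (M : Type v) [L.Structure M] : Prop :=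
  InfFormula.Realize M φ PEmpty.elim

/-- `L_{κμ}`-equivalence of two structures: the same `L_{κμ}`-sentences hold in them. -/
def InfEquivalent (L : FirstOrder.Language.{0, 0}) (κ μ : Cardinal.{u})
    (M : Type v) (N : Type w) [L.Structure M] [L.Structure N] : Prop :=
  ∀ φ : InfSentence L κ μ, φ.Holds M ↔ φ.Holds N

/-- The function symbols of the vocabulary of (abelian) groups: a constant and a binary symbol. -/
inductive GroupFunctions : ℕ → Type
  | zero : GroupFunctions 0
  | add : GroupFunctions 2

/-- The vocabulary `{+, 0}` of (abelian) groups; it has no relation symbols but equality. -/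
def groupVocabulary : FirstOrder.Language.{0, 0} where
  Functions := GroupFunctions
  Relations := fun _ => Empty

/-- An abelian group as a structure for the vocabulary of groups. -/
instance groupStructure (G : Type v) [AddCommGroup G] : groupVocabulary.Structure G where
  funMap := fun {_} f =>
    match f with
    | .zero => fun _ => 0
    | .add => fun x => x 0 + x 1
  RelMap := fun {_} R => R.elim

/-- A Whitehead group (W-group): an abelian group `G` with `Ext¹(G, ℤ) = 0`. The copy `ULift ℤ`
of `ℤ` only serves to place `ℤ` in the universe of `G`. -/
def IsWhiteheadGroup (G : Type v) [AddCommGroup G] : Prop :=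
  Subsingleton (CategoryTheory.Abelian.Ext
    (ModuleCat.of ℤ G) (ModuleCat.of ℤ (ULift.{v} ℤ)) 1)

/-! The unit vectors of `ℤ^ω` are independent, their span is pure at 3, and each series `∑ 3 ^ k • s
k • e k` with 0-1 coefficients has a sum; a single sentence of the logic asserts that such a
sequence exists (`threeAdicSentence_holds_iff`). A W-group contains no such sequence `a`
(`IsWhiteheadGroup.not_hasThreeAdicSums`). Indeed, letting `s` run over the branches `x` of the
binary tree gives continuum many sums `z x 0`, independent modulo the span of `a`. As 2 is prime to
3, every `f : (ℕ → Bool) → Bool` is encoded by a character into `ℚ/ℤ` that kills `a` and is 1/2 or 0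
at `z x 0` according to `f x` (`exists_character`). Since `Ext¹(G, ℤ) = 0`, it lifts to a map into
`ℚ`, whose values on `a` determine `f` by 3-adic divisibility. So `2 ^ 2 ^ ℵ₀` functions would
inject into `ℕ → ℚ`, which has size `2 ^ ℵ₀`. -/

open CategoryTheory

/-! ### Integral linear equations as formulas -/

/-- The sum of a list of variables, as a term in the vocabulary of groups. -/
def sumTerm {α : Type v} : List α → groupVocabulary.Term α
  | [] => .func GroupFunctions.zero Fin.elim0
  | i :: l => .func GroupFunctions.add ![.var i, sumTerm l]

lemma realize_sumTerm {α : Type v} {G : Type w} [AddCommGroup G] (a : α → G) (l : List α) :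
    (sumTerm l).realize a = (l.map a).sum := by
  induction l with
  | nil => rfl
  | cons i l ih =>
    rw [List.map_cons, List.sum_cons, ← ih]
    rfl

/-- The formula expressing that an integral linear combination of variables vanishes. -/
noncomputable def linearEquation {κ μ : Cardinal.{u}} {α : Type u} (c : α →₀ ℤ) :
    InfFormula groupVocabulary κ μ α :=
  -- The vocabulary has no subtraction, so the positive part of `c` is equated with the negative
  -- part.
  .equal (sumTerm (Finsupp.toMultiset (c.mapRange Int.toNat rfl)).toList)
    (sumTerm (Finsupp.toMultiset ((-c).mapRange Int.toNat rfl)).toList)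

lemma sum_map_toMultiset {α : Type u} {G : Type w} [AddCommGroup G] (a : α → G) (c : α →₀ ℕ) :
    ((Finsupp.toMultiset c).toList.map a).sum = c.sum fun i n => n • a i := by
  rw [← Multiset.sum_coe, ← Multiset.map_coe, Multiset.coe_toList]
  induction c using Finsupp.induction_linear with
  | zero => simp
  | add f g hf hg =>
    rw [map_add, Multiset.map_add, Multiset.sum_add, hf, hg,
      Finsupp.sum_add_index' (h := fun i n => n • a i) (fun _ => zero_nsmul _)
        (fun _ _ _ => add_nsmul _ _ _)]
  | single i n => simp [Multiset.map_nsmul, Multiset.sum_nsmul]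

lemma realize_linearEquation {κ μ : Cardinal.{u}} {α : Type u} {G : Type w} [AddCommGroup G]
    (c : α →₀ ℤ) (a : α → G) :
    (linearEquation (κ := κ) (μ := μ) c).Realize G a ↔ Finsupp.linearCombination ℤ a c = 0 := by
  have key : Finsupp.linearCombination ℤ a c
      = (c.mapRange Int.toNat rfl).sum (fun i n => n • a i)
        - ((-c).mapRange Int.toNat rfl).sum (fun i n => n • a i) := by
    rw [Finsupp.sum_mapRange_index (h := fun i n => n • a i) (fun _ => zero_nsmul _),
      Finsupp.sum_mapRange_index (h := fun i n => n • a i) (fun _ => zero_nsmul _),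
      Finsupp.sum_neg_index (by simp), ← Finsupp.sum_sub, Finsupp.linearCombination_apply]
    refine Finsupp.sum_congr fun i _ => ?_
    rw [← natCast_zsmul, ← natCast_zsmul, ← sub_smul, Int.toNat_sub_toNat_neg]
  rw [key, sub_eq_zero, ← sum_map_toMultiset, ← sum_map_toMultiset, ← realize_sumTerm,
    ← realize_sumTerm]
  rfl

/-! ### Adically complete sequences -/

/-- The sequence `a` is independent and spans a subgroup that is pure at the prime `3`. -/
def IsThreePure {G : Type w} [AddCommGroup G] (a : ℕ → G) : Prop :=
  ∀ (n : ℕ) (c : ℕ →₀ ℤ) (g : G), Finsupp.linearCombination ℤ a c = (3 ^ n : ℤ) • g →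
    ∀ k, (3 ^ n : ℤ) ∣ c k

/-- The series `∑ 3 ^ k • s k • a k`, with `s` any sequence of zeros and ones, have `3`-adic sums:
`z n` is the sum of `3 ^ (k - n) • s k • a k` over `k ≥ n`. -/
def HasThreeAdicSums {G : Type w} [AddCommGroup G] (a : ℕ → G) : Prop :=
  ∀ s : ℕ → Bool, ∃ z : ℕ → G, ∀ n, z n = (if s n then (1 : ℤ) else 0) • a n + (3 : ℤ) • z (n + 1)

/-- The index set for the instances of purity. -/
abbrev PurityIndex : Type := {p : ℕ × (ℕ →₀ ℤ) // ∃ k, ¬ (3 ^ p.1 : ℤ) ∣ p.2 k}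

lemma lt_succ_continuum_of_countable (ι : Type) [Countable ι] :
    Cardinal.mk ι < Order.succ ((2 : Cardinal.{0}) ^ Cardinal.aleph0.{0}) :=
  Order.lt_succ_of_le (Cardinal.mk_le_aleph0.trans (Cardinal.cantor _).le)

lemma lt_succ_continuum_sequences :
    Cardinal.mk (ℕ → Bool) < Order.succ ((2 : Cardinal.{0}) ^ Cardinal.aleph0.{0}) :=
  Order.lt_succ_of_le (by simp)

lemma lt_aleph_one_of_countable (ι : Type) [Countable ι] :
    Cardinal.mk ι < Cardinal.aleph.{0} 1 :=
  Cardinal.mk_le_aleph0.trans_lt Cardinal.aleph0_lt_aleph_one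

/-- The sentence asserting that there is a sequence that is pure at `3` and has `3`-adic sums. -/
noncomputable def threeAdicSentence :
    InfSentence groupVocabulary (Order.succ ((2 : Cardinal.{0}) ^ Cardinal.aleph0.{0}))
      (Cardinal.aleph.{0} 1) :=
  .ex ℕ (lt_aleph_one_of_countable _) <| .conj Bool (lt_succ_continuum_of_countable _) fun b =>
    match b with
    | true => .conj PurityIndex (lt_succ_continuum_of_countable _) fun p =>
        .neg <| .ex Unit (lt_aleph_one_of_countable _) <| linearEquation <|
          p.1.2.mapDomain (fun k => Sum.inl (Sum.inr k)) - .single (Sum.inr ()) (3 ^ p.1.1 : ℤ)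
    -- Only this conjunction has continuum many members; it is what requires `κ` to exceed the
    -- continuum.
    | false => .conj (ℕ → Bool) lt_succ_continuum_sequences fun s =>
        .ex ℕ (lt_aleph_one_of_countable _) <| .conj ℕ (lt_succ_continuum_of_countable _) fun n =>
          linearEquation <| .single (Sum.inr n) 1
            - .single (Sum.inl (Sum.inr n)) (if s n then (1 : ℤ) else 0)
            - .single (Sum.inr (n + 1)) 3

lemma threeAdicSentence_holds_iff (G : Type w) [AddCommGroup G] :
    threeAdicSentence.Holds G ↔ ∃ a : ℕ → G, IsThreePure a ∧ HasThreeAdicSums a := by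
  simp only [threeAdicSentence, InfSentence.Holds, InfFormula.Realize, Bool.forall_bool,
    realize_linearEquation, map_sub, Finsupp.linearCombination_single,
    Finsupp.linearCombination_mapDomain, Sum.elim_inr, Sum.elim_inl, one_zsmul]
  refine exists_congr fun a => (and_comm.trans (and_congr ?_ ?_))
  · constructor
    · intro h n c g hc k
      by_contra hk
      exact h ⟨(n, c), k, hk⟩ ⟨fun _ => g, sub_eq_zero.2 hc⟩
    · rintro h ⟨⟨n, c⟩, k, hk⟩ ⟨g, hg⟩
      exact hk (h n c (g ()) (sub_eq_zero.1 hg) k)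
  · refine forall_congr' fun s => exists_congr fun z => forall_congr' fun n => ?_
    rw [sub_sub, sub_eq_zero]

lemma isThreePure_single : IsThreePure fun k : ℕ => (Pi.single k 1 : ℕ → ℤ) := by
  intro n c g h k
  have hk := congrFun h k
  refine ⟨g k, ?_⟩
  have hc : Finsupp.linearCombination ℤ (fun k : ℕ => (Pi.single k 1 : ℕ → ℤ)) c k = c k := by
    rw [Finsupp.linearCombination_apply, Finsupp.sum, Finset.sum_apply]
    simpa [Pi.single_apply] using Eq.symm
  rw [← hc, hk]
  rfl

lemma hasThreeAdicSums_single : HasThreeAdicSums fun k : ℕ => (Pi.single k 1 : ℕ → ℤ) := by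
  intro s
  refine ⟨fun n k => if n ≤ k then 3 ^ (k - n) * (if s k then 1 else 0) else 0, fun n => ?_⟩
  ext k
  rcases lt_trichotomy n k with h | rfl | h
  · obtain ⟨d, rfl⟩ := Nat.exists_eq_add_of_lt h
    have h1 : n + d + 1 - n = d + 1 := by omega
    have h2 : n + d + 1 - (n + 1) = d := by omega
    cases hs : s n <;> simp [h.le, h.ne', h1, h2, pow_succ', -Nat.add_eq_left]
  · cases hs : s n <;> simp [hs]
  · cases hs : s n <;> simp [h.not_ge, h.ne, h.not_gt]

/-! ### An almost disjoint family -/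

/-- The set of codes of the initial segments of `x`, as a sequence of zeros and ones. -/
noncomputable def branch (x : ℕ → Bool) : ℕ → Bool := by
  classical
  exact fun k => decide (∃ n, k = Encodable.encode ((List.range n).map x))

lemma branch_encode (x y : ℕ → Bool) (n : ℕ) :
    branch y (Encodable.encode ((List.range n).map x)) = true ↔ ∀ i < n, y i = x i := by
  simp only [branch, decide_eq_true_eq, Encodable.encode_inj]
  constructor
  · rintro ⟨m, hm⟩ i hi
    obtain rfl : n = m := by simpa using congrArg List.length hm
    exact ((List.map_inj_left.1 hm) i (List.mem_range.2 hi)).symm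
  · exact fun h => ⟨n, List.map_inj_left.2 fun i hi => (h i (List.mem_range.1 hi)).symm⟩

/-- Distinct branches of the binary tree share finitely many nodes, so all long enough initial
segments of `x` lie on no other branch from `F`; infinitely many nodes remain to avoid `b`. -/
lemma exists_branch_separating (F : Finset (ℕ → Bool)) (x : ℕ → Bool) (b : Finset ℕ) :
    ∃ k, k ∉ b ∧ branch x k = true ∧ ∀ y ∈ F, y ≠ x → branch y k = false := by
  classical
  have hdiff : ∀ y : ℕ → Bool, ∃ i, y ≠ x → y i ≠ x i := fun y => by
    by_cases h : y = x
    · exact ⟨0, fun h' => (h' h).elim⟩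
    · obtain ⟨i, hi⟩ := Function.ne_iff.1 h
      exact ⟨i, fun _ => hi⟩
  choose d hd using hdiff
  let N := F.sup d + 1
  have hinj : Function.Injective
      fun n : ℕ => Encodable.encode ((List.range (N + n)).map x) := fun m n h => by
    simpa using congrArg List.length (Encodable.encode_injective h)
  obtain ⟨n, hn⟩ := ((Set.infinite_range_of_injective hinj).exists_notMem_finset b)
  obtain ⟨⟨m, rfl⟩, hm⟩ := hn
  refine ⟨_, hm, (branch_encode x x _).2 fun _ _ => rfl, fun y hy hyx => ?_⟩
  rw [Bool.eq_false_iff, Ne, branch_encode]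
  intro h
  exact hd y hyx (h _ (by have := Finset.le_sup (f := d) hy; omega))

/-! ### Independence of the adic sums -/

lemma eq_partial_sum_add {G : Type w} [AddCommGroup G] {a z : ℕ → G} {s : ℕ → Bool}
    (hz : ∀ n, z n = (if s n then (1 : ℤ) else 0) • a n + (3 : ℤ) • z (n + 1)) (n : ℕ) :
    z 0 = Finsupp.linearCombination ℤ a
      (∑ k ∈ Finset.range n, .single k (if s k then (3 ^ k : ℤ) else 0)) + (3 ^ n : ℤ) • z n := by
  induction n with
  | zero => simp
  | succ n ih =>
    rw [Finset.sum_range_succ, map_add, Finsupp.linearCombination_single, ih, hz n, smul_add,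
      smul_smul, smul_smul, pow_succ, ← add_assoc]
    simp

/-- At a node `k` on the branch `x` alone and outside the support of `b`, the relation has
coefficient `-3 ^ k * m x`. Truncating the series at `N` leaves a multiple of `3 ^ N`, so purity
makes `3 ^ N` divide this coefficient, for `N` as large as desired. -/
lemma eq_zero_of_linearCombination_mem_span {G : Type w} [AddCommGroup G] {a : ℕ → G}
    (ha : IsThreePure a) {z : (ℕ → Bool) → ℕ → G}
    (hz : ∀ x n, z x n = (if branch x n then (1 : ℤ) else 0) • a n + (3 : ℤ) • z x (n + 1))
    {m : (ℕ → Bool) →₀ ℤ}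
    (hm : Finsupp.linearCombination ℤ (fun x => z x 0) m ∈ Submodule.span ℤ (Set.range a)) :
    m = 0 := by
  classical
  ext x
  by_contra hx
  rw [Finsupp.mem_span_range_iff_exists_finsupp] at hm
  obtain ⟨b, hb⟩ := hm
  obtain ⟨k, hkb, hkx, hk⟩ := exists_branch_separating m.support x b.support
  obtain ⟨n, hn⟩ : ∃ n : ℕ, (3 ^ k * m x).natAbs < 3 ^ n := ⟨_, Nat.lt_pow_self (by norm_num)⟩
  have hle : (3 : ℕ) ^ n ≤ 3 ^ (n + k + 1) := Nat.pow_le_pow_right (by norm_num) (by omega)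
  -- `N > k` keeps the index `k` in the truncated sums, and `N ≥ n` makes `3 ^ N` exceed the
  -- coefficient.
  set N := n + k + 1 with hN
  let p : (ℕ → Bool) → (ℕ →₀ ℤ) := fun y =>
    ∑ k ∈ Finset.range N, .single k (if branch y k then (3 ^ k : ℤ) else 0)
  have hp : ∀ y, p y k = if branch y k then (3 ^ k : ℤ) else 0 := fun y => by
    have : k < N := by omega
    simp [p, Finsupp.finsetSum_apply, Finsupp.single_apply, this]
  have key : Finsupp.linearCombination ℤ a (b - m.sum fun y c => c • p y)
      = (3 ^ N : ℤ) • m.sum fun y c => c • z y N := by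
    rw [map_sub, Finsupp.linearCombination_apply, hb, Finsupp.linearCombination_apply,
      Finsupp.sum, Finsupp.sum, Finsupp.sum, map_sum, Finset.smul_sum, ← Finset.sum_sub_distrib]
    refine Finset.sum_congr rfl fun y _ => ?_
    rw [map_smul, smul_comm, ← smul_sub]
    congr 1
    exact sub_eq_iff_eq_add'.2 (eq_partial_sum_add (hz y) N)
  have hdvd := ha _ _ _ key k
  have hval : (m.sum fun y c => c • p y) k = 3 ^ k * m x := by
    rw [Finsupp.sum, Finsupp.finsetSum_apply, Finset.sum_eq_single x]
    · simp [hp, hkx, mul_comm]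
    · intro y hy hyx
      simp [hp, hk y hy hyx]
    · intro h
      simp [Finsupp.notMem_support_iff.1 h]
  rw [Finsupp.sub_apply, hval, Finsupp.notMem_support_iff.1 hkb, zero_sub, dvd_neg] at hdvd
  have := Int.natAbs_dvd_natAbs.2 hdvd
  rw [Int.natAbs_pow] at this
  have h0 := Nat.eq_zero_of_dvd_of_lt this (hn.trans_le hle)
  exact hx (by simpa using h0)

/-! ### Characters -/

/-- `φ` factors through `F / ker j`, which embeds in `C`, and `ℚ/ℤ` is injective. -/
lemma CharacterModule.exists_comp_eq {F : Type v} {C : Type w} [AddCommGroup F] [AddCommGroup C]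
    (j : F →ₗ[ℤ] C) (φ : F →ₗ[ℤ] AddCircle (1 : ℚ)) (h : LinearMap.ker j ≤ LinearMap.ker φ) :
    ∃ Φ : C →+ AddCircle (1 : ℚ), ∀ x, Φ (j x) = φ x := by
  obtain ⟨Φ, hΦ⟩ := CharacterModule.dual_surjective_of_injective ((LinearMap.ker j).liftQ j le_rfl)
    (LinearMap.ker_eq_bot.1 (Submodule.ker_liftQ_eq_bot' _ _ rfl))
    (((LinearMap.ker j).liftQ φ h).toAddMonoidHom)
  exact ⟨Φ, fun x => DFunLike.congr_fun hΦ (Submodule.Quotient.mk x)⟩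

/-- The elements `g` of which some multiple `3 ^ N • g` is, modulo the span of `a`, twice a
combination of the `y x`. -/
def evenClosure {G : Type w} [AddCommGroup G] {X : Type v} (a : ℕ → G) (y : X → G) :
    Submodule ℤ G where
  carrier := {g | ∃ (N : ℕ) (d : X →₀ ℤ), (3 ^ N : ℤ) • g
    - (2 : ℤ) • Finsupp.linearCombination ℤ y d ∈ Submodule.span ℤ (Set.range a)}
  zero_mem' := ⟨0, 0, by simp⟩
  add_mem' := by
    rintro g h ⟨M, d, hd⟩ ⟨N, e, he⟩
    refine ⟨M + N, (3 ^ N : ℤ) • d + (3 ^ M : ℤ) • e, ?_⟩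
    convert add_mem (Submodule.smul_mem _ (3 ^ N : ℤ) hd) (Submodule.smul_mem _ (3 ^ M : ℤ) he)
      using 1
    simp only [map_add, map_smul]
    module
  smul_mem' := by
    rintro c g ⟨N, d, hd⟩
    refine ⟨N, c • d, ?_⟩
    convert Submodule.smul_mem _ c hd using 1
    simp only [map_smul]
    module

/-- Modulo `evenClosure` the `z x 0` are independent over the field with two elements: a relation
`c` yields `3 ^ N * c x = 2 * d x`, so every `c x` is even. Hence values of order at most 2 can be
prescribed freely. -/
lemma exists_character {G : Type w} [AddCommGroup G] {a : ℕ → G}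
    (ha : IsThreePure a) {z : (ℕ → Bool) → ℕ → G}
    (hz : ∀ x n, z x n = (if branch x n then (1 : ℤ) else 0) • a n + (3 : ℤ) • z x (n + 1))
    (f : (ℕ → Bool) → Bool) :
    ∃ φ : G →+ AddCircle (1 : ℚ), (∀ k, φ (a k) = 0) ∧ (∀ x n, φ ((2 : ℤ) • z x n) = 0) ∧
      ∀ x, φ (z x 0) = if f x then ((2⁻¹ : ℚ) : AddCircle (1 : ℚ)) else 0 := by
  let D := evenClosure a fun x => z x 0
  let j := D.mkQ ∘ₗ Finsupp.linearCombination ℤ fun x => z x 0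
  let v : (ℕ → Bool) → AddCircle (1 : ℚ) :=
    fun x => if f x then ((2⁻¹ : ℚ) : AddCircle (1 : ℚ)) else 0
  have hv : ∀ x, (2 : ℤ) • v x = 0 := fun x => by
    by_cases h : f x
    · simp only [v, h, if_true]
      rw [← AddCircle.coe_zsmul, AddCircle.coe_eq_zero_iff]
      exact ⟨1, by norm_num⟩
    · simp [v, h]
  have hker : LinearMap.ker j ≤ LinearMap.ker (Finsupp.linearCombination ℤ v) := by
    intro c hc
    rw [LinearMap.mem_ker, LinearMap.comp_apply, Submodule.mkQ_apply,
      Submodule.Quotient.mk_eq_zero] at hc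
    obtain ⟨N, d, hd⟩ := hc
    rw [← map_smul, ← map_smul, ← map_sub] at hd
    have h0 := eq_zero_of_linearCombination_mem_span ha hz hd
    rw [LinearMap.mem_ker, Finsupp.linearCombination_apply]
    refine Finset.sum_eq_zero fun x _ => ?_
    have hx : 3 ^ N * c x - 2 * d x = 0 := by simpa using DFunLike.congr_fun h0 x
    have heven : Even (c x) := by
      have : Even (3 ^ N * c x) := ⟨d x, by linarith⟩
      rcases Int.even_mul.1 this with h | h
      · exact absurd h (by simp [Int.even_pow, show ¬ Even (3 : ℤ) by decide])
      · exact h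
    obtain ⟨e, he⟩ := heven
    change c x • v x = 0
    rw [he, ← two_mul, mul_comm, mul_smul, hv, smul_zero]
  obtain ⟨Φ, hΦ⟩ := CharacterModule.exists_comp_eq j _ hker
  refine ⟨Φ.comp D.mkQ.toAddMonoidHom, fun k => ?_, fun x n => ?_, fun x => ?_⟩
  · have : a k ∈ D := ⟨0, 0, by simpa using Submodule.subset_span (Set.mem_range_self k)⟩
    have h0 : D.mkQ (a k) = 0 := (Submodule.Quotient.mk_eq_zero _).2 this
    change Φ (D.mkQ (a k)) = 0
    rw [h0, map_zero]
  · have : (2 : ℤ) • z x n ∈ D := by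
      -- `3 ^ n • z x n` differs from `z x 0` by a partial sum, which lies in the span of `a`.
      refine ⟨n, .single x 1, ?_⟩
      rw [Finsupp.linearCombination_single, one_smul, eq_partial_sum_add (hz x) n, smul_add,
        smul_comm, ← sub_sub, sub_right_comm, sub_self, zero_sub]
      exact neg_mem (Submodule.smul_mem _ _
        (Finsupp.mem_span_range_iff_exists_finsupp.2 ⟨_, rfl⟩))
    have h0 : D.mkQ ((2 : ℤ) • z x n) = 0 := (Submodule.Quotient.mk_eq_zero _).2 this
    change Φ (D.mkQ ((2 : ℤ) • z x n)) = 0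
    rw [h0, map_zero]
  · have := hΦ (.single x 1)
    simpa [j, v] using this

/-! ### Whitehead groups -/

/-- In the long exact sequence of `0 → ℤ → ℚ → ℚ/ℤ → 0`, the obstruction to lifting lies in `Ext¹(G,
ℤ) = 0`. -/
lemma IsWhiteheadGroup.exists_lift {G : Type v} [AddCommGroup G] (hG : IsWhiteheadGroup G)
    (φ : G →+ AddCircle (1 : ℚ)) : ∃ ψ : G →+ ℚ, ∀ g, φ g = (ψ g : AddCircle (1 : ℚ)) := by
  let i : ULift.{v} ℤ →ₗ[ℤ] ULift.{v} ℚ := (ULift.moduleEquiv.symm.toLinearMap ∘ₗ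
    (Int.castAddHom ℚ).toIntLinearMap) ∘ₗ ULift.moduleEquiv.toLinearMap
  let q : ULift.{v} ℚ →ₗ[ℤ] ULift.{v} (AddCircle (1 : ℚ)) := (ULift.moduleEquiv.symm.toLinearMap ∘ₗ
    (QuotientAddGroup.mk' (AddSubgroup.zmultiples (1 : ℚ))).toIntLinearMap) ∘ₗ
      ULift.moduleEquiv.toLinearMap
  have hiq : ∀ x, q x = 0 ↔ ∃ n, i n = x := by
    rintro ⟨x⟩
    have h1 : q ⟨x⟩ = 0 ↔ (x : AddCircle (1 : ℚ)) = 0 :=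
      ULift.moduleEquiv.symm.map_eq_zero_iff (R := ℤ) (M := AddCircle (1 : ℚ))
    rw [h1, AddCircle.coe_eq_zero_iff]
    constructor
    · rintro ⟨n, hn⟩
      exact ⟨⟨n⟩, ULift.ext _ _ (by
        rw [zsmul_eq_mul, mul_one] at hn
        exact hn)⟩
    · rintro ⟨⟨n⟩, hn⟩
      exact ⟨n, by
        rw [zsmul_eq_mul, mul_one]
        exact congrArg ULift.down hn⟩
  let S : ShortComplex (ModuleCat.{v} ℤ) := ShortComplex.mk (ModuleCat.ofHom i) (ModuleCat.ofHom q)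
    (ModuleCat.hom_ext (LinearMap.ext fun n => (hiq _).2 ⟨n, rfl⟩))
  have hS : S.ShortExact :=
    { exact := (ShortComplex.moduleCat_exact_iff _).2 fun x hx => (hiq x).1 hx
      mono_f := (ModuleCat.mono_iff_injective _).2 fun m n h => by
        have := congrArg ULift.down h
        exact ULift.ext _ _ (Int.cast_injective (α := ℚ) this)
      epi_g := (ModuleCat.epi_iff_surjective _).2 fun ⟨y⟩ => by
        obtain ⟨x, rfl⟩ := QuotientAddGroup.mk_surjective y
        exact ⟨⟨x⟩, rfl⟩ }
  let φ' : ModuleCat.of ℤ G ⟶ S.X₃ :=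
    ModuleCat.ofHom (ULift.moduleEquiv.symm.toLinearMap ∘ₗ φ.toIntLinearMap)
  obtain ⟨x₂, hx₂⟩ := Abelian.Ext.covariant_sequence_exact₃ (ModuleCat.of ℤ G) hS
    (Abelian.Ext.mk₀ φ') (zero_add 1) (hG.elim _ _)
  obtain ⟨ψ, rfl⟩ := (Abelian.Ext.mk₀_bijective _ _).2 x₂
  rw [Abelian.Ext.mk₀_comp_mk₀] at hx₂
  have hψ := (Abelian.Ext.mk₀_bijective _ _).1 hx₂
  refine ⟨(ULift.moduleEquiv.toLinearMap ∘ₗ ψ.hom : G →ₗ[ℤ] ℚ).toAddMonoidHom, fun g => ?_⟩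
  exact congrArg ULift.down (ConcreteCategory.congr_hom hψ g).symm

lemma eq_zero_of_forall_three_pow_dvd {t : ℚ} (ht : ∀ n : ℕ, ∃ m : ℤ, t = 3 ^ n * m) : t = 0 := by
  obtain ⟨t₀, h₀⟩ := ht 0
  rw [pow_zero, one_mul] at h₀
  -- The exponent `|t₀|` suffices because `3 ^ |t₀| > |t₀|`.
  have hdvd : (3 : ℤ) ^ (t₀.natAbs) ∣ t₀ := by
    obtain ⟨m, hm⟩ := ht t₀.natAbs
    exact ⟨m, by rw [h₀] at hm; exact_mod_cast hm⟩
  have h := Int.natAbs_dvd_natAbs.2 hdvd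
  rw [Int.natAbs_pow] at h
  have := Nat.eq_zero_of_dvd_of_lt h (Nat.lt_pow_self (by norm_num))
  rw [h₀, Int.natAbs_eq_zero.1 this, Int.cast_zero]

theorem IsWhiteheadGroup.not_hasThreeAdicSums {G : Type v} [AddCommGroup G]
    (hG : IsWhiteheadGroup G) {a : ℕ → G} (ha : IsThreePure a) : ¬ HasThreeAdicSums a := by
  intro hsum
  choose z hz using fun x => hsum (branch x)
  choose φ hφa hφ2 hφz using exists_character ha hz
  choose ψ hψ using fun f => hG.exists_lift (φ f)
  have hinj : Function.Injective fun f k => ψ f (a k) := by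
    intro f g hfg
    have hA : ∀ c, (ψ f - ψ g) (Finsupp.linearCombination ℤ a c) = 0 := fun c => by
      rw [Finsupp.linearCombination_apply, Finsupp.sum, map_sum]
      refine Finset.sum_eq_zero fun k _ => ?_
      rw [map_zsmul, AddMonoidHom.sub_apply, show ψ f (a k) = ψ g (a k) from congrFun hfg k,
        sub_self, smul_zero]
    have hint : ∀ x n, ∃ m : ℤ, (ψ f - ψ g) ((2 : ℤ) • z x n) = m := fun x n => by
      have h : (((ψ f - ψ g) ((2 : ℤ) • z x n) : ℚ) : AddCircle (1 : ℚ)) = 0 := by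
        rw [AddMonoidHom.sub_apply, AddCircle.coe_sub, ← hψ, ← hψ, hφ2, hφ2, sub_zero]
      obtain ⟨m, hm⟩ := AddCircle.coe_eq_zero_iff _ |>.1 h
      exact ⟨m, by simpa using hm.symm⟩
    -- `ψ f - ψ g` kills `a`, so its value at `2 • z x 0` is `3 ^ n` times its integral value at `2
    -- • z x n`, for every `n`.
    have hzero : ∀ x, (ψ f - ψ g) ((2 : ℤ) • z x 0) = 0 := fun x => by
      refine eq_zero_of_forall_three_pow_dvd fun n => ?_
      obtain ⟨m, hm⟩ := hint x n
      refine ⟨m, ?_⟩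
      rw [eq_partial_sum_add (hz x) n, smul_add, map_add, map_zsmul, hA, smul_zero, zero_add,
        smul_comm, map_zsmul, hm, zsmul_eq_mul]
      push_cast
      rfl
    have heq : ∀ x, φ f (z x 0) = φ g (z x 0) := fun x => by
      have h := hzero x
      rw [map_zsmul, smul_eq_zero, AddMonoidHom.sub_apply, sub_eq_zero] at h
      rw [hψ, hψ, h.resolve_left two_ne_zero]
    have hhalf : ((2⁻¹ : ℚ) : AddCircle (1 : ℚ)) ≠ 0 := by
      rw [Ne, AddCircle.coe_eq_zero_iff]
      rintro ⟨n, hn⟩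
      have h2 : (n : ℚ) * 2 = 1 := by
        rw [zsmul_eq_mul, mul_one] at hn
        rw [hn]; norm_num
      have h3 : n * 2 = 1 := by exact_mod_cast h2
      omega
    funext x
    have hx := heq x
    rw [hφz, hφz] at hx
    cases hf : f x <;> cases hg : g x <;>
      simp only [hf, hg, Bool.false_eq_true, if_true, if_false] at hx
    · rfl
    · exact absurd hx.symm hhalf
    · exact absurd hx hhalf
    · rfl
  have hcard : Cardinal.mk (ℕ → ℚ) = Cardinal.mk (ℕ → Bool) := by simp
  obtain ⟨e⟩ := Cardinal.eq.1 hcard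
  -- Subsets of `ℕ → Bool`, read as functions `f`, would inject into `ℕ → Bool`.
  refine Function.cantor_injective
    (fun s : Set (ℕ → Bool) => e fun k => ψ (fun x => by classical exact decide (x ∈ s)) (a k)) ?_
  intro s t hst
  have h := hinj (e.injective hst)
  ext x
  simpa using congrFun h x

theorem corollary1p9 (G : Type u) [AddCommGroup G] (hG : IsWhiteheadGroup G) :
    ¬ InfEquivalent groupVocabulary (Order.succ ((2 : Cardinal.{0}) ^ Cardinal.aleph0.{0}))
      (Cardinal.aleph.{0} 1) (ℕ → ℤ) G := by
  intro h
  obtain ⟨a, ha, hsum⟩ := (threeAdicSentence_holds_iff G).1 <| (h threeAdicSentence).1 <|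
    (threeAdicSentence_holds_iff (ℕ → ℤ)).2 ⟨_, isThreePure_single, hasThreeAdicSums_single⟩
  exact hG.not_hasThreeAdicSums ha hsum
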